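/- Let $\Omega$ be a finite set of states, $p\in\Delta(\Omega)$ a prior with full support, $N=\{1,\dots,n\}$ a finite set of receivers, and for each state $\omega$ let $v^\omega:\Delta(\Omega)^N\to\mathbb R$ be an upper semicontinuous utility of the sender. An information structure $I$ consists of measurable spaces of signals $S_1,\dots,S_n$ and, for each $\omega$, a probability measure $\pi(\cdot\mid\omega)$ on $S_1\times\dots\times S_n$. Together with $p$ it determines the joint law $\mathbb P_I$ of the state and the signals, and the posterior beliefs $x_i\in\Delta(\Omega)$, $x_i(\omega)=\mathbb P_I(\omega\mid s_i)$, of the receivers. The value of the persuasion problem is $$\mathrm{Val}=\max_I \mathbb E_I\big[v^\omega(x_1,\dots,x_n)\big],$$ where the maximum over all information structures is attained. **Proposition (dual value representation).** $$\mathrm{Val}=\inf\ \sum_{\omega\in\Omega}p(\omega)V^\omega ,$$ where the infimum is over all real numbers $V^\omega$ and continuous functions $\varphi_i^\omega:\Delta(\Omega)\to\mathbb R$ ($\omega\in\Omega$, $i\in N$) such that $$v^\omega(x_1,\dots,x_n)\le V^\omega+\sum_{i\in N}\varphi_i^\omega(x_i)\quad\text{for all }\omega\in\Omega,\ x_1,\dots,x_n\in\Delta(\Omega),$$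 $$\sum_{\omega\in\Omega}x(\omega)\varphi_i^\omega(x)=0\quad\text{for all }i\in N,\ x\in\Delta(\Omega).$$ If every $v^\omega$ is continuous, the infimum is attained. Moreover, write $|x-x'|=\sum_{\omega}|x(\omega)-x'(\omega)|$, $p_{\min}=\min_\omega p(\omega)$, $\|v\|_\infty=\max_{\omega,x_1,\dots,x_n}|v^\omega(x_1,\dots,x_n)|$, and let $D_v(\varepsilon)$ be the maximum of $|v^\omega(x_1,\dots,x_{i-1},x,x_{i+1},\dots,x_n)-v^\omega(x_1,\dots,x_{i-1},x',x_{i+1},\dots,x_n)|$ over all $\omega$, $i$, $x_j$ ($j\ne i$) and $x,x'$ with $|x-x'|\le\varepsilon$. Then there is an optimal $(V^\omega,\varphi_i^\omega)$ that satisfies, for all $\omega\in\Omega$, $i\in N$ and $x,x'\in\Delta(\Omega)$, $$-\|v\|_\infty\le V^\omega\le\frac{2-p(\omega)}{p(\omega)}\|v\|_\infty,\qquad -\frac{2}{p(\omega)}\|v\|_\infty\le\varphi_i^\omega(x)\le\Big(2+\frac{2}{p_{\min}}\Big)\|v\|_\infty,$$ $$|\varphi_i^\omega(x)-\varphi_i^\omega(x')|\le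 2D_v(|x-x'|)+\frac{2n}{p_{\min}}\|v\|_\infty\,|x-x'|.$$ -/

import Mathlib

open MeasureTheory ProbabilityTheory

universe u w t

namespace Persuasion

/-- `Belief Ω` is the simplex `Δ(Ω)` of probability vectors on the finite set `Ω`, with the topology
and the Borel σ-algebra that it inherits from `Ω → ℝ`. -/
abbrev Belief (Ω : Type u) [Fintype Ω] : Type u := stdSimplex ℝ Ω

/-- An element of the simplex as a measure on the set of states. -/
noncomputable def priorMeasure {Ω : Type u} [Fintype Ω] [MeasurableSpace Ω] (p : Belief Ω) :
    Measure Ω :=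
  ∑ ω, ENNReal.ofReal (p ω) • Measure.dirac ω

instance {Ω : Type u} [Fintype Ω] [MeasurableSpace Ω] (p : Belief Ω) :
    IsProbabilityMeasure (priorMeasure p) where
  measure_univ := by
    have h : ∑ ω, ENNReal.ofReal (p ω) = 1 := by
      rw [← ENNReal.ofReal_sum_of_nonneg fun ω _ => stdSimplex.zero_le p ω]
      simp
    simpa [priorMeasure] using h

/-- The vector of point masses of a probability measure on a finite set. -/
noncomputable def toBelief {Ω : Type u} [Fintype Ω] [MeasurableSpace Ω] [DiscreteMeasurableSpace Ω]
    (ν : Measure Ω) [IsProbabilityMeasure ν] : Belief Ω :=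
  ⟨fun ω => ν.real {ω}, fun _ => measureReal_nonneg, by simp⟩

/-- An information structure: a measurable space of signals for each receiver, and for each state
a joint distribution of the signals of all receivers (a probability measure on the product
σ-algebra; since `Ω` is finite and discrete, the kernel is just a family indexed by states). -/
structure InfoStructure (Ω : Type u) [MeasurableSpace Ω] (N : Type w) where
  /-- The set of signals of a receiver. -/
  Signal : N → Type t
  [measurableSpace : ∀ i, MeasurableSpace (Signal i)]
  /-- The joint distribution of signals conditional on the state. -/
  law : Kernel Ω (∀ i, Signal i)
  [isMarkov : IsMarkovKernel law]

attribute [instance] InfoStructure.measurableSpace InfoStructure.isMarkov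

section

variable {Ω : Type u} [Fintype Ω] [Nonempty Ω] [MeasurableSpace Ω] [DiscreteMeasurableSpace Ω]
  {N : Type w}

/-- The joint distribution of the state and the signals. -/
noncomputable def InfoStructure.joint (I : InfoStructure.{u, w, t} Ω N) (p : Belief Ω) :
    Measure (Ω × (∀ i, I.Signal i)) :=
  priorMeasure p ⊗ₘ I.law

/-- The conditional distribution of the signal of receiver `i` given the state. -/
noncomputable def InfoStructure.signalLaw (I : InfoStructure.{u, w, t} Ω N) (i : N) :
    Kernel Ω (I.Signal i) :=
  I.law.map fun s => s i

instance (I : InfoStructure.{u, w, t} Ω N) (i : N) : IsMarkovKernel (I.signalLaw i) :=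
  Kernel.IsMarkovKernel.map I.law (measurable_pi_apply i)

/-- The posterior belief of receiver `i` who knows the prior and the information structure and
has received the signal `s`. It is determined up to a null set of signals. -/
noncomputable def InfoStructure.belief (I : InfoStructure.{u, w, t} Ω N) (p : Belief Ω) (i : N)
    (s : I.Signal i) : Belief Ω :=
  toBelief (((I.signalLaw i)†(priorMeasure p)) s)

/-- The sender's ex post utility, as a function of the realized state and signals. -/
noncomputable def InfoStructure.utility (I : InfoStructure.{u, w, t} Ω N) (p : Belief Ω)
    (v : Ω → (N → Belief Ω) → ℝ) (z : Ω × (∀ i, I.Signal i)) : ℝ :=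
  v z.1 fun i => I.belief p i (z.2 i)

/-- The finite expected utilities that the sender can reach by the choice of an information
structure. For an upper semicontinuous `v` the utility is bounded above, so that a non-integrable
one has expectation `-∞` and plays no role in the sender's maximization. -/
def payoffs (p : Belief Ω) (v : Ω → (N → Belief Ω) → ℝ) : Set ℝ :=
  {r | ∃ I : InfoStructure.{u, w, t} Ω N,
    Integrable (I.utility p v) (I.joint p) ∧ r = ∫ z, I.utility p v z ∂(I.joint p)}

/-- The value of the persuasion problem: the optimal expected utility of the sender. -/
noncomputable def value (p : Belief Ω) (v : Ω → (N → Belief Ω) → ℝ) : ℝ :=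
  sSup (payoffs.{u, w, t} p v)

end

section

variable {Ω : Type u} [Fintype Ω] {N : Type w} [Fintype N]

/-- The constraints of the dual problem on the numbers `V ω` and the functions `φ ω i`. -/
structure DualFeasible (v : Ω → (N → Belief Ω) → ℝ) (V : Ω → ℝ) (φ : Ω → N → Belief Ω → ℝ) :
    Prop where
  continuous : ∀ ω i, Continuous (φ ω i)
  le : ∀ ω x, v ω x ≤ V ω + ∑ i, φ ω i (x i)
  orthogonal : ∀ i (x : Belief Ω), ∑ ω, x ω * φ ω i x = 0

/-- The values of the dual objective at the feasible points of the dual problem. -/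
def dualValues (p : Belief Ω) (v : Ω → (N → Belief Ω) → ℝ) : Set ℝ :=
  {r | ∃ V φ, DualFeasible v V φ ∧ r = ∑ ω, p ω * V ω}

/-- The distance `∑ ω, |x ω - x' ω|` of two beliefs. -/
def tvDist (x x' : Belief Ω) : ℝ := ∑ ω, |x ω - x' ω|

/-- The sup-norm of the utility function. -/
noncomputable def supNorm (v : Ω → (N → Belief Ω) → ℝ) : ℝ :=
  ⨆ z : Ω × (N → Belief Ω), |v z.1 z.2|

open Classical in
/-- The modulus of continuity of the utility function: its largest oscillation when the belief of a
single receiver is moved by at most `ε`. -/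
noncomputable def modulus (v : Ω → (N → Belief Ω) → ℝ) (ε : ℝ) : ℝ :=
  sSup {d | ∃ (ω : Ω) (i : N) (y : N → Belief Ω) (x x' : Belief Ω), tvDist x x' ≤ ε ∧
    d = |v ω (Function.update y i x) - v ω (Function.update y i x')|}

end

end Persuasion

/-! Weak duality: evaluate the inequality constraint at the posteriors and integrate. Given the
signal of receiver `i`, the state has law `x_i`, so the conditional expectation of `φ ω i` is `∑ ω,
x ω * φ ω i x` at `x = x_i`, which vanishes (`DualFeasible.payoff_le`).

Strong duality: information structures are replaced by plans, that is, measures `μ ω` of mass `p ω`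
on profiles of beliefs that annihilate the functions orthogonal in the dual sense. Hahn–Banach and
Riesz turn a lower bound `c` of the dual values into a plan whose integral of every continuous
majorant of `v` is at least `c` (`exists_isPlan`); sup-convolutions and Fatou carry this bound over
to `v`. Telling each receiver the belief drawn by the plan implements it, because annihilation
forces the posterior to be the announced belief (`IsPlan.map_eval_eq_withDensity`,
`IsPlan.Implements.belief_ae_eq`). With `c` the dual infimum, the primal maximum is attained and
there is no gap.

Dual attainment for continuous `v`: replace the functions of one receiver by the least ones that the
inequality allows, then subtract their `x`-average to restore orthogonality. This keeps `V` and
gives a priori bounds and a modulus of continuity (`DualFeasible.isRegular_tighten`). The dual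
points with these bounds are compact for pointwise convergence, so a minimizer exists. -/

namespace Persuasion

/-! ### Weak duality -/

section

variable {Ω : Type u} [Fintype Ω]

theorem continuous_belief_apply (ω : Ω) : Continuous fun x : Belief Ω => x ω :=
  (continuous_apply ω).comp continuous_subtype_val

theorem measurable_belief_of_apply {α : Type*} [MeasurableSpace α] {f : α → Belief Ω}
    (h : ∀ ω, Measurable fun a => f a ω) : Measurable f :=
  Measurable.subtype_mk (measurable_pi_iff.2 h)

variable [MeasurableSpace Ω] [DiscreteMeasurableSpace Ω]

theorem priorMeasure_singleton (p : Belief Ω) (ω : Ω) :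
    priorMeasure p {ω} = ENNReal.ofReal (p ω) := by
  classical
  simp [priorMeasure, Set.indicator_apply]

theorem toBelief_apply (ν : Measure Ω) [IsProbabilityMeasure ν] (ω : Ω) :
    toBelief ν ω = ν.real {ω} := rfl

theorem toBelief_priorMeasure (p : Belief Ω) : toBelief (priorMeasure p) = p := by
  refine stdSimplex.ext (funext fun ω => ?_)
  rw [toBelief_apply, measureReal_def, priorMeasure_singleton,
    ENNReal.toReal_ofReal (stdSimplex.zero_le p ω)]

theorem integral_priorMeasure (p : Belief Ω) (f : Ω → ℝ) :
    ∫ ω, f ω ∂(priorMeasure p) = ∑ ω, p ω * f ω := by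
  rw [integral_fintype .of_finite]
  simp [measureReal_def, priorMeasure_singleton, ENNReal.toReal_ofReal (stdSimplex.zero_le p _)]

theorem integral_toBelief (ν : Measure Ω) [IsProbabilityMeasure ν] (f : Ω → ℝ) :
    ∫ ω, f ω ∂ν = ∑ ω, toBelief ν ω * f ω := by
  rw [integral_fintype .of_finite]
  simp [toBelief_apply]

theorem measurable_toBelief {α : Type*} [MeasurableSpace α] (κ : Kernel α Ω) [IsMarkovKernel κ] :
    Measurable fun a => toBelief (κ a) :=
  measurable_belief_of_apply fun ω =>
    (Kernel.measurable_coe κ (MeasurableSet.singleton ω)).ennreal_toReal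

section

variable [Nonempty Ω] {N : Type w} (I : InfoStructure.{u, w, t} Ω N) (p : Belief Ω)

theorem InfoStructure.measurable_belief (i : N) : Measurable (I.belief p i) :=
  measurable_toBelief _

instance : IsProbabilityMeasure (I.joint p) := by
  unfold InfoStructure.joint; infer_instance

omit [DiscreteMeasurableSpace Ω] [Nonempty Ω] in
theorem InfoStructure.joint_map (i : N) :
    (I.joint p).map (Prod.map id fun s => s i) = priorMeasure p ⊗ₘ I.signalLaw i := by
  rw [InfoStructure.joint, InfoStructure.signalLaw, Measure.compProd_map (measurable_pi_apply i)]

/-- The martingale property of posteriors, tested against functions of the state and the belief. -/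
theorem InfoStructure.integral_joint_belief (i : N) {φ : Ω → Belief Ω → ℝ}
    (hφ : ∀ ω, Continuous (φ ω)) :
    Integrable (fun z => φ z.1 (I.belief p i (z.2 i))) (I.joint p) ∧
    ∫ z, φ z.1 (I.belief p i (z.2 i)) ∂(I.joint p) =
      ∫ s, ∑ ω, I.belief p i s ω * φ ω (I.belief p i s) ∂(I.signalLaw i ∘ₘ priorMeasure p) := by
  have hm : Measurable fun z : Ω × I.Signal i => φ z.1 (I.belief p i z.2) :=
    measurable_from_prod_countable_right fun ω =>
      (hφ ω).measurable.comp (I.measurable_belief p i)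
  obtain ⟨C, hC⟩ : ∃ C, ∀ ω x, ‖φ ω x‖ ≤ C := by
    have h : ∀ ω, ∃ C, ∀ x, ‖φ ω x‖ ≤ C := fun ω => by
      obtain ⟨C, hC⟩ := isCompact_univ.exists_bound_of_continuousOn (hφ ω).continuousOn
      exact ⟨C, fun x => hC x trivial⟩
    choose C hC using h
    exact ⟨∑ ω, |C ω|, fun ω x => ((hC ω x).trans (le_abs_self _)).trans
      (Finset.single_le_sum (f := fun ω => |C ω|) (fun _ _ => abs_nonneg _) (Finset.mem_univ ω))⟩
  have hpm : Measurable (Prod.map id fun s => s i : Ω × (∀ i, I.Signal i) → Ω × I.Signal i) :=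
    measurable_id.prodMap (measurable_pi_apply i)
  have hint : Integrable (fun z : Ω × I.Signal i => φ z.1 (I.belief p i z.2))
      (priorMeasure p ⊗ₘ I.signalLaw i) :=
    .of_bound hm.aestronglyMeasurable C (ae_of_all _ fun z => hC _ _)
  have hj := I.joint_map p i
  refine ⟨?_, ?_⟩
  · rw [← hj] at hint
    exact hint.comp_measurable hpm
  · have h1 : ∫ z, φ z.1 (I.belief p i (z.2 i)) ∂(I.joint p) =
        ∫ z, φ z.1 (I.belief p i z.2) ∂(priorMeasure p ⊗ₘ I.signalLaw i) := by
      rw [← hj, integral_map hpm.aemeasurable hm.aestronglyMeasurable]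
      rfl
    -- Bayes' rule: the joint law of state and signal also disintegrates as signal marginal times
    -- posterior.
    have h2 := compProd_posterior_eq_map_swap (κ := I.signalLaw i) (μ := priorMeasure p)
    have h3 : ∫ z, φ z.1 (I.belief p i z.2) ∂(priorMeasure p ⊗ₘ I.signalLaw i) =
        ∫ y, φ y.2 (I.belief p i y.1) ∂((I.signalLaw i ∘ₘ priorMeasure p) ⊗ₘ
          (I.signalLaw i)†(priorMeasure p)) := by
      rw [h2, integral_map measurable_swap.aemeasurable]
      · rfl
      · exact (hm.comp measurable_swap).aestronglyMeasurable
    rw [h1, h3, Measure.integral_compProd]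
    · exact integral_congr_ae (ae_of_all _ fun s => integral_toBelief _ _)
    · exact .of_bound (hm.comp measurable_swap).aestronglyMeasurable C (ae_of_all _ fun z => hC _ _)

/-- The `φ` terms have mean zero by the martingale property, so only the mean of `V` survives
integration. -/
theorem DualFeasible.payoff_le [Fintype N] {v : Ω → (N → Belief Ω) → ℝ} {V : Ω → ℝ}
    {φ : Ω → N → Belief Ω → ℝ} (h : DualFeasible v V φ) {r : ℝ}
    (hr : r ∈ payoffs.{u, w, t} p v) : r ≤ ∑ ω, p ω * V ω := by
  obtain ⟨I, hI, rfl⟩ := hr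
  have hφ : ∀ i, Integrable (fun z => φ z.1 i (I.belief p i (z.2 i))) (I.joint p) ∧
      ∫ z, φ z.1 i (I.belief p i (z.2 i)) ∂(I.joint p) = 0 := fun i => by
    have := I.integral_joint_belief p i (φ := fun ω => φ ω i) fun ω => h.continuous ω i
    refine ⟨this.1, this.2.trans ?_⟩
    simp [h.orthogonal]
  have hV : Integrable (fun z : Ω × (∀ i, I.Signal i) => V z.1) (I.joint p) :=
    .of_bound ((measurable_of_finite V).comp measurable_fst).aestronglyMeasurable
      (∑ ω, |V ω|) (ae_of_all _ fun z => Finset.single_le_sum (f := fun ω => |V ω|)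
        (fun _ _ => abs_nonneg _) (Finset.mem_univ z.1))
  have hVi : ∫ z, V z.1 ∂(I.joint p) = ∑ ω, p ω * V ω := by
    rw [← integral_priorMeasure, ← Measure.fst_compProd (priorMeasure p) I.law, Measure.fst,
      integral_map measurable_fst.aemeasurable (measurable_of_finite V).aestronglyMeasurable]
    rfl
  calc ∫ z, I.utility p v z ∂(I.joint p)
      ≤ ∫ z, (V z.1 + ∑ i, φ z.1 i (I.belief p i (z.2 i))) ∂(I.joint p) :=
        integral_mono hI (hV.add (integrable_finsetSum _ fun i _ => (hφ i).1)) fun z =>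
          h.le z.1 fun i => I.belief p i (z.2 i)
    _ = ∑ ω, p ω * V ω := by
        rw [integral_add hV (integrable_finsetSum _ fun i _ => (hφ i).1),
          integral_finsetSum _ fun i _ => (hφ i).1, hVi]
        simp [(hφ _).2]

end

end

end Persuasion

/-! ### Plans and the information structures that implement them -/

namespace Persuasion

section

variable {Ω : Type u} [Fintype Ω]

/-- A copy of the simplex `Δ(Ω)` in an arbitrary universe. -/
abbrev BeliefCode (Ω : Type u) [Fintype Ω] : Type t :=
  ULift.{t} (Belief (Fin (Fintype.card Ω)))

/-- The encoding of beliefs as signals. -/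
noncomputable def encode (x : Belief Ω) : BeliefCode.{u, t} Ω :=
  ⟨stdSimplex.map (Fintype.equivFin Ω) x⟩

/-- The belief that is encoded by a signal. -/
noncomputable def decode (s : BeliefCode.{u, t} Ω) : Belief Ω :=
  stdSimplex.map (Fintype.equivFin Ω).symm s.down

theorem decode_encode (x : Belief Ω) : decode (encode.{u, t} x) = x := by
  simp [decode, encode, stdSimplex.map_comp_apply]

theorem measurable_encode : Measurable (encode.{u, t} (Ω := Ω)) :=
  measurable_up.comp (stdSimplex.continuous_map _).measurable

theorem measurable_decode : Measurable (decode.{u, t} (Ω := Ω)) :=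
  (stdSimplex.continuous_map _).measurable.comp measurable_down

variable {N : Type w}

/-- The measures `μ ω` are the joint distributions of the state `ω` and of a profile of beliefs
that are the posteriors of receivers who observe them: `p` is the marginal on states, and the
martingale property holds when tested against continuous functions. -/
structure IsPlan (p : Belief Ω) (μ : Ω → Measure (N → Belief Ω)) : Prop where
  isFinite : ∀ ω, IsFiniteMeasure (μ ω)
  mass : ∀ ω, μ ω Set.univ = ENNReal.ofReal (p ω)
  orthogonal : ∀ (i : N) (φ : Ω → Belief Ω → ℝ), (∀ ω, Continuous (φ ω)) →
    (∀ x : Belief Ω, ∑ ω, x ω * φ ω x = 0) → ∑ ω, ∫ x, φ ω (x i) ∂(μ ω) = 0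

namespace IsPlan

variable {p : Belief Ω} {μ : Ω → Measure (N → Belief Ω)}

/-- In a plan, the belief of a receiver is the density of the state conditional on that belief. -/
theorem map_eval_eq_withDensity (h : IsPlan p μ) (i : N) (ω : Ω) :
    (μ ω).map (fun x => x i) =
      (∑ ω', (μ ω').map fun x => x i).withDensity fun x => ENNReal.ofReal (x ω) := by
  classical
  have := h.isFinite
  have hmi : Measurable fun x : N → Belief Ω => x i := measurable_pi_apply i
  have hmω := (continuous_belief_apply ω).measurable
  have : IsFiniteMeasure ((∑ ω', (μ ω').map fun x => x i).withDensity
      fun x : Belief Ω => ENNReal.ofReal (x ω)) := by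
    refine isFiniteMeasure_withDensity (ne_top_of_le_ne_top
      (measure_ne_top (∑ ω', (μ ω').map fun x => x i) Set.univ)
      ((lintegral_mono fun x => ENNReal.ofReal_le_one.2 (stdSimplex.le_one x ω)).trans_eq ?_))
    simp
  refine ext_of_forall_integral_eq_of_IsFiniteMeasure fun f => ?_
  have hfc (ω' : Ω) : Continuous fun x : Belief Ω => x ω * f x :=
    (continuous_belief_apply ω).mul f.continuous
  have hint (ω' : Ω) (g : Belief Ω → ℝ) (hg : Continuous g) :
      Integrable (fun x : N → Belief Ω => g (x i)) (μ ω') := by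
    obtain ⟨C, hC⟩ := isCompact_univ.exists_bound_of_continuousOn hg.continuousOn
    exact .of_bound (hg.measurable.comp hmi).aestronglyMeasurable C
      (ae_of_all _ fun x => hC _ trivial)
  have hmap (ω' : Ω) (g : Belief Ω → ℝ) (hg : Continuous g) :
      ∫ x, g x ∂((μ ω').map fun x => x i) = ∫ x, g (x i) ∂(μ ω') :=
    integral_map hmi.aemeasurable hg.measurable.aestronglyMeasurable
  rw [integral_withDensity_eq_integral_toReal_smul hmω.ennreal_ofReal
    (ae_of_all _ fun _ => ENNReal.ofReal_lt_top)]
  simp_rw [ENNReal.toReal_ofReal (stdSimplex.zero_le _ ω), smul_eq_mul]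
  rw [integral_finsetSum_measure, hmap ω _ f.continuous, Finset.sum_congr rfl fun ω' _ =>
    hmap ω' _ (hfc ω')]
  -- This test function is orthogonal because `∑ ω', x ω' = 1`: both of its parts have `x`-average
  -- `x ω * f x`.
  · have key := h.orthogonal i (fun ω' x => (if ω' = ω then f x else 0) - x ω * f x)
      (fun ω' => by
        split_ifs
        · exact f.continuous.sub (hfc ω)
        · exact continuous_const.sub (hfc ω))
      fun x => by
        have hs : ∑ ω', x ω' = 1 := stdSimplex.sum_eq_one x
        simp [mul_sub, Finset.sum_sub_distrib, ← Finset.sum_mul, hs]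
    have h2 (ω' : Ω) : ∫ x, ((if ω' = ω then f (x i) else 0) - x i ω * f (x i)) ∂(μ ω') =
        (if ω' = ω then ∫ x, f (x i) ∂(μ ω) else 0) - ∫ x, x i ω * f (x i) ∂(μ ω') := by
      rw [integral_sub _ (hint ω' _ (hfc ω'))]
      · split_ifs with hω
        · rw [hω]
        · simp
      · split_ifs
        · exact hint ω' _ f.continuous
        · exact integrable_zero _ _ _
    simp_rw [h2, Finset.sum_sub_distrib] at key
    simpa [sub_eq_zero] using key
  · intro ω' _
    rw [integrable_map_measure (hfc ω').measurable.aestronglyMeasurable hmi.aemeasurable]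
    exact hint ω' _ (hfc ω')


variable [MeasurableSpace Ω] [DiscreteMeasurableSpace Ω]

omit [Fintype Ω] in
theorem _root_.MeasureTheory.Measure.ext_prod_singleton [Finite Ω] {T : Type*} [MeasurableSpace T]
    {m m' : Measure (T × Ω)}
    (H : ∀ s, MeasurableSet s → ∀ ω, m (s ×ˢ {ω}) = m' (s ×ˢ {ω})) : m = m' := by
  ext E hE
  have hE' : E = ⋃ ω, ((fun s => (s, ω)) ⁻¹' E) ×ˢ {ω} := by
    ext ⟨s, ω⟩; simp
  have hd : Pairwise (Function.onFun Disjoint fun ω => ((fun s => (s, ω)) ⁻¹' E) ×ˢ ({ω} : Set Ω)) :=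
    fun ω ω' hne => Set.disjoint_left.2 fun z hz hz' => hne (hz.2.symm.trans hz'.2)
  have hms (ω : Ω) : MeasurableSet ((fun s => (s, ω)) ⁻¹' E) := measurable_prodMk_right hE
  rw [hE', measure_iUnion hd fun ω => (hms ω).prod (.singleton ω),
    measure_iUnion hd fun ω => (hms ω).prod (.singleton ω)]
  exact tsum_congr fun ω => H _ (hms ω) ω

/-- The kernel of distributions of the state that is given by a measurable belief. -/
noncomputable def _root_.Persuasion.beliefKernel {T : Type*} [MeasurableSpace T]
    (d : T → Belief Ω) (hd : Measurable d) : Kernel T Ω where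
  toFun s := priorMeasure (d s)
  measurable' := by
    refine Measure.measurable_of_measurable_coe _ fun s hs => ?_
    simp only [priorMeasure, Measure.finsetSum_apply, Measure.smul_apply, smul_eq_mul]
    refine Finset.measurable_fun_sum _ fun ω _ => Measurable.mul_const ?_ _
    exact ((continuous_belief_apply ω).measurable.comp hd).ennreal_ofReal

instance _root_.Persuasion.isMarkovKernel_beliefKernel {T : Type*} [MeasurableSpace T]
    (d : T → Belief Ω) (hd : Measurable d) : IsMarkovKernel (beliefKernel d hd) :=
  ⟨fun s => inferInstanceAs (IsProbabilityMeasure (priorMeasure (d s)))⟩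

/-- The information structure `I` reveals to each receiver an encoding of the belief
in the plan `μ`. -/
structure Implements (p : Belief Ω) (μ : Ω → Measure (N → Belief Ω))
    (I : InfoStructure.{u, w, t} Ω N) (enc : ∀ i, Belief Ω → I.Signal i)
    (dec : ∀ i, I.Signal i → Belief Ω) : Prop where
  measurable_enc : ∀ i, Measurable (enc i)
  measurable_dec : ∀ i, Measurable (dec i)
  dec_enc : ∀ i x, dec i (enc i x) = x
  law_eq : ∀ ω, ENNReal.ofReal (p ω) • I.law ω = (μ ω).map fun x i => enc i (x i)

namespace Implements

variable {I : InfoStructure.{u, w, t} Ω N} {enc : ∀ i, Belief Ω → I.Signal i}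
  {dec : ∀ i, I.Signal i → Belief Ω} (hI : Implements p μ I enc dec)

include hI

omit [DiscreteMeasurableSpace Ω] in
theorem measurable_enc_pi : Measurable fun (x : N → Belief Ω) i => enc i (x i) :=
  measurable_pi_lambda _ fun i => (hI.measurable_enc i).comp (measurable_pi_apply i)

omit [DiscreteMeasurableSpace Ω] in
theorem signalLaw_eq (i : N) (ω : Ω) :
    ENNReal.ofReal (p ω) • I.signalLaw i ω = ((μ ω).map fun x => x i).map (enc i) := by
  rw [InfoStructure.signalLaw, Kernel.map_apply _ (measurable_pi_apply i), ← Measure.map_smul,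
    hI.law_eq, Measure.map_map (measurable_pi_apply i) hI.measurable_enc_pi,
    Measure.map_map (hI.measurable_enc i) (measurable_pi_apply i)]
  rfl

theorem joint_eq : I.joint p = ∑ ω, (μ ω).map fun x => (ω, fun i => enc i (x i)) := by
  ext s hs
  rw [InfoStructure.joint, Measure.compProd_apply hs, priorMeasure, lintegral_finsetSum_measure,
    Measure.finsetSum_apply]
  refine Finset.sum_congr rfl fun ω _ => ?_
  rw [lintegral_smul_measure, lintegral_dirac, ← Measure.smul_apply, hI.law_eq,
    Measure.map_apply (measurable_const.prodMk hI.measurable_enc_pi) hs,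
    Measure.map_apply hI.measurable_enc_pi (measurable_prodMk_left hs)]
  rfl

theorem signal_marginal (i : N) :
    I.signalLaw i ∘ₘ priorMeasure p = (∑ ω, (μ ω).map fun x => x i).map (enc i) := by
  ext s hs
  rw [Measure.bind_apply hs (Kernel.aemeasurable _), priorMeasure, lintegral_finsetSum_measure,
    Measure.map_apply (hI.measurable_enc i) hs, Measure.finsetSum_apply]
  refine Finset.sum_congr rfl fun ω _ => ?_
  rw [lintegral_smul_measure, lintegral_dirac, ← Measure.smul_apply, hI.signalLaw_eq,
    Measure.map_apply (hI.measurable_enc i) hs]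

variable [Nonempty Ω]

/-- Posteriors are almost surely unique, so it suffices that the decoded belief disintegrates the
joint law. On a rectangle `s ×ˢ {ω}` this is the density formula `map_eval_eq_withDensity`. -/
theorem belief_ae_eq (h : IsPlan p μ) (i : N) :
    ∀ᵐ s ∂(I.signalLaw i ∘ₘ priorMeasure p), I.belief p i s = dec i s := by
  have hd := hI.measurable_dec i
  have he := hI.measurable_enc i
  have key : (I.signalLaw i ∘ₘ priorMeasure p) ⊗ₘ beliefKernel (dec i) hd =
      (priorMeasure p ⊗ₘ I.signalLaw i).map Prod.swap := by
    refine Measure.ext_prod_singleton fun s hs ω => ?_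
    have hmd : Measurable fun s => ENNReal.ofReal (dec i s ω) :=
      ((continuous_belief_apply ω).measurable.comp hd).ennreal_ofReal
    rw [Measure.map_apply measurable_swap (hs.prod (.singleton ω)), Set.preimage_swap_prod,
      Measure.compProd_apply_prod (.singleton ω) hs, Measure.compProd_apply_prod hs (.singleton ω),
      lintegral_singleton, priorMeasure_singleton, mul_comm, ← smul_eq_mul, ← Measure.smul_apply,
      hI.signalLaw_eq, map_eval_eq_withDensity h, hI.signal_marginal,
      Measure.map_apply he hs, withDensity_apply _ (he hs)]
    change ∫⁻ a in s, priorMeasure (dec i a) {ω} ∂_ = _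
    simp_rw [priorMeasure_singleton]
    rw [setLIntegral_map hs hmd he]
    simp_rw [hI.dec_enc]
  filter_upwards [ae_eq_posterior_of_compProd_eq key] with s hs
  have hs' : posterior (I.signalLaw i) (priorMeasure p) s = priorMeasure (dec i s) := hs.symm
  simp_rw [InfoStructure.belief, hs']
  exact toBelief_priorMeasure _

theorem utility_ae_eq [Finite N] (h : IsPlan p μ) (v : Ω → (N → Belief Ω) → ℝ) :
    I.utility p v =ᵐ[I.joint p] fun z => v z.1 fun i => dec i (z.2 i) := by
  have H (i : N) : ∀ᵐ z ∂(I.joint p), I.belief p i (z.2 i) = dec i (z.2 i) := by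
    have h1 := hI.belief_ae_eq h i
    rw [← Measure.snd_compProd, ← InfoStructure.joint_map, Measure.snd,
      Measure.map_map measurable_snd (measurable_id.prodMap (measurable_pi_apply i))] at h1
    exact ae_of_ae_map
      (measurable_snd.comp (measurable_id.prodMap (measurable_pi_apply i))).aemeasurable h1
  filter_upwards [ae_all_iff.2 H] with z hz
  simp only [InfoStructure.utility, hz]

theorem mem_payoffs [Finite N] (h : IsPlan p μ) {v : Ω → (N → Belief Ω) → ℝ} (hv : ∀ ω, Measurable (v ω))
    (hi : ∀ ω, Integrable (v ω) (μ ω)) :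
    ∑ ω, ∫ x, v ω x ∂(μ ω) ∈ payoffs.{u, w, t} p v := by
  have hu := hI.utility_ae_eq h v
  have hg : Measurable fun z : Ω × (∀ i, I.Signal i) => v z.1 fun i => dec i (z.2 i) :=
    measurable_from_prod_countable_right fun ω => (hv ω).comp
      (measurable_pi_lambda _ fun i => (hI.measurable_dec i).comp (measurable_pi_apply i))
  have hm (ω : Ω) : Measurable fun x : N → Belief Ω => (ω, fun i => enc i (x i)) :=
    measurable_const.prodMk hI.measurable_enc_pi
  have hi' (ω : Ω) : Integrable (fun z : Ω × (∀ i, I.Signal i) => v z.1 fun i => dec i (z.2 i))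
      ((μ ω).map fun x => (ω, fun i => enc i (x i))) := by
    rw [integrable_map_measure hg.aestronglyMeasurable (hm ω).aemeasurable]
    simpa [Function.comp_def, hI.dec_enc] using hi ω
  refine ⟨I, ?_, ?_⟩
  · rw [integrable_congr hu, hI.joint_eq]
    exact integrable_finsetSum_measure.2 fun ω _ => hi' ω
  · rw [integral_congr_ae hu, hI.joint_eq, integral_finsetSum_measure fun ω _ => hi' ω]
    refine Finset.sum_congr rfl fun ω _ => ?_
    rw [integral_map (hm ω).aemeasurable hg.aestronglyMeasurable]
    simp [hI.dec_enc]

end Implements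

/-- Every plan is implemented by an information structure. -/
theorem exists_implements (h : IsPlan p μ) (hp : ∀ ω, 0 < p ω) :
    ∃ (I : InfoStructure.{u, w, t} Ω N) (enc : ∀ i, Belief Ω → I.Signal i)
      (dec : ∀ i, I.Signal i → Belief Ω), Implements p μ I enc dec := by
  have hmeas : Measurable fun (x : N → Belief Ω) i => encode.{u, t} (x i) :=
    measurable_pi_lambda _ fun i => measurable_encode.comp (measurable_pi_apply i)
  -- Conditioning on `ω` divides `μ ω` by its mass `p ω`, which is positive by full support.
  let κ : Kernel Ω (N → BeliefCode.{u, t} Ω) := Kernel.ofFunOfCountable fun ω =>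
    (ENNReal.ofReal (p ω))⁻¹ • (μ ω).map fun x i => encode.{u, t} (x i)
  have hκ : IsMarkovKernel κ := by
    refine ⟨fun ω => ⟨?_⟩⟩
    change (ENNReal.ofReal (p ω))⁻¹ • (μ ω).map (fun x i => encode.{u, t} (x i)) Set.univ = 1
    rw [Measure.map_apply hmeas .univ, Set.preimage_univ, h.mass, smul_eq_mul]
    exact ENNReal.inv_mul_cancel (by simpa using hp ω) ENNReal.ofReal_ne_top
  refine ⟨⟨fun _ => BeliefCode.{u, t} Ω, κ⟩, fun _ => encode, fun _ => decode,
    fun _ => measurable_encode, fun _ => measurable_decode, fun _ => decode_encode, fun ω => ?_⟩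
  change ENNReal.ofReal (p ω) • ((ENNReal.ofReal (p ω))⁻¹ • (μ ω).map _) = _
  rw [smul_smul, ENNReal.mul_inv_cancel (by simpa using hp ω) ENNReal.ofReal_ne_top, one_smul]

theorem mem_payoffs [Nonempty Ω] [Finite N] (h : IsPlan p μ) (hp : ∀ ω, 0 < p ω)
    {v : Ω → (N → Belief Ω) → ℝ} (hv : ∀ ω, Measurable (v ω))
    (hi : ∀ ω, Integrable (v ω) (μ ω)) :
    ∑ ω, ∫ x, v ω x ∂(μ ω) ∈ payoffs.{u, w, t} p v := by
  obtain ⟨_, _, _, hI⟩ := h.exists_implements hp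
  exact hI.mem_payoffs h hv hi

end IsPlan

end

end Persuasion

/-! ### Semicontinuous approximation, Hahn–Banach and Riesz -/

open Filter Topology in
/-- An upper semicontinuous function on a metric space that is bounded above is the pointwise
limit of continuous functions above it with the same bound. -/
theorem UpperSemicontinuous.exists_continuous_tendsto {X : Type*} [PseudoMetricSpace X] {f : X → ℝ}
    (hf : UpperSemicontinuous f) {B : ℝ} (hB : ∀ x, f x ≤ B) :
    ∃ g : ℕ → X → ℝ, (∀ k, Continuous (g k)) ∧ (∀ k x, f x ≤ g k x) ∧ (∀ k x, g k x ≤ B) ∧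
      ∀ x, Tendsto (fun k => g k x) atTop (𝓝 (f x)) := by
  have hle (k : ℕ) (x y : X) : f y - k * dist x y ≤ B :=
    (sub_le_self _ (by positivity)).trans (hB y)
  have hbdd (k : ℕ) (x : X) : BddAbove (Set.range fun y => f y - k * dist x y) :=
    ⟨B, Set.forall_mem_range.2 (hle k x)⟩
  have hlow (k : ℕ) (x : X) : f x ≤ ⨆ y, f y - k * dist x y := by
    simpa using le_ciSup (hbdd k x) x
  -- Sup-convolution: the `k`-th function is `k`-Lipschitz.
  refine ⟨fun k x => ⨆ y, f y - k * dist x y, fun k => ?_, hlow, fun k x => ?_, fun x => ?_⟩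
  · refine (LipschitzWith.of_le_add_mul (k : NNReal) fun x z => ?_).continuous
    have : Nonempty X := ⟨x⟩
    refine ciSup_le fun y => ?_
    have h1 := le_ciSup (hbdd k z) y
    have h2 : (k : ℝ) * dist z y ≤ k * (dist x z + dist x y) := by
      gcongr
      rw [dist_comm x z]
      exact dist_triangle z x y
    simp only [NNReal.coe_natCast]
    linarith
  · have : Nonempty X := ⟨x⟩
    exact ciSup_le (hle k x)
  · have : Nonempty X := ⟨x⟩
    refine tendsto_order.2 ⟨fun a ha => .of_forall fun k => ha.trans_le (hlow k x), fun a ha => ?_⟩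
    obtain ⟨b, hb, hba⟩ := exists_between ha
    obtain ⟨δ, hδ, hball⟩ := Metric.eventually_nhds_iff.1 (hf x b hb)
    -- For `k ≥ K`, a point `y` at distance at least `δ` contributes at most `B - k * δ ≤ b`.
    obtain ⟨K, hK⟩ := exists_nat_ge ((B - b) / δ)
    filter_upwards [eventually_ge_atTop K] with k hk
    refine (ciSup_le fun y => ?_).trans_lt hba
    rcases lt_or_ge (dist y x) δ with h | h
    · exact (sub_le_self _ (by positivity)).trans (hball h).le
    · have h1 : (B - b) / δ ≤ k := hK.trans (Nat.cast_le.2 hk)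
      rw [div_le_iff₀ hδ] at h1
      have h2 : (k : ℝ) * δ ≤ k * dist x y := by
        rw [dist_comm]; gcongr
      linarith [hB y]

/-- A version of the Hahn–Banach theorem: a convex cone in `E × ℝ` that lies above the origin and
projects onto `E` lies above the graph of a linear functional. -/
theorem exists_linearMap_le_of_cone {E : Type*} [AddCommGroup E] [Module ℝ E] (R : E → ℝ → Prop)
    (hsmul : ∀ a : ℝ, 0 < a → ∀ g r, R g r → R (a • g) (a * r))
    (hadd : ∀ g g' r r', R g r → R g' r' → R (g + g') (r + r'))
    (hne : ∀ g, ∃ r, R g r) (hzero : ∀ r, R 0 r → 0 ≤ r) :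
    ∃ L : E →ₗ[ℝ] ℝ, ∀ g r, R g r → L g ≤ r := by
  -- The map `g ↦ sInf {r | R g r}` is the sublinear majorant for Hahn–Banach. It is finite because
  -- a point over `g` plus a point over `-g` lies over the origin.
  have hbdd (g : E) : BddBelow {r | R g r} := by
    obtain ⟨r', hr'⟩ := hne (-g)
    refine ⟨-r', fun r hr => ?_⟩
    have := hadd _ _ _ _ hr hr'
    rw [add_neg_cancel] at this
    linarith [hzero _ this]
  have hne' (g : E) : {r | R g r}.Nonempty := hne g
  have hsmul' (a : ℝ) (ha : 0 < a) (g : E) : a * sInf {r | R g r} ≤ sInf {r | R (a • g) r} := by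
    refine le_csInf (hne' _) fun r hr => ?_
    have h1 := hsmul a⁻¹ (inv_pos.2 ha) _ _ hr
    rw [smul_smul, inv_mul_cancel₀ ha.ne', one_smul] at h1
    have h2 := csInf_le (hbdd g) h1
    rwa [le_inv_mul_iff₀ ha] at h2
  have hhom (a : ℝ) (ha : 0 < a) (g : E) : sInf {r | R (a • g) r} = a * sInf {r | R g r} := by
    refine le_antisymm ?_ (hsmul' a ha g)
    have := hsmul' a⁻¹ (inv_pos.2 ha) (a • g)
    rwa [smul_smul, inv_mul_cancel₀ ha.ne', one_smul, inv_mul_le_iff₀ ha] at this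
  have hsub (g g' : E) : sInf {r | R (g + g') r} ≤ sInf {r | R g r} + sInf {r | R g' r} := by
    rw [← sub_le_iff_le_add']
    refine le_csInf (hne' _) fun r' hr' => ?_
    rw [sub_le_comm]
    refine le_csInf (hne' _) fun r hr => ?_
    rw [sub_le_iff_le_add]
    exact csInf_le (hbdd _) (hadd _ _ _ _ hr hr')
  have hbot (x : (⊥ : E →ₗ.[ℝ] ℝ).domain) : (⊥ : E →ₗ.[ℝ] ℝ) x ≤ sInf {r | R x r} := by
    obtain rfl : x = 0 := Subtype.ext x.2
    rw [LinearPMap.map_zero]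
    exact le_csInf (hne' _) fun r hr => hzero r hr
  obtain ⟨L, -, hL⟩ := exists_extension_of_le_sublinear ⊥ (fun g => sInf {r | R g r}) hhom hsub hbot
  exact ⟨L, fun g r hr => (hL g).trans (csInf_le (hbdd g) hr)⟩

/-- The Riesz–Markov–Kakutani theorem for positive functionals on `C(X, ℝ)`, `X` compact. -/
theorem ContinuousMap.exists_measure_integral_eq {X : Type*} [TopologicalSpace X] [CompactSpace X]
    [T2Space X] [MeasurableSpace X] [BorelSpace X] (Λ : C(X, ℝ) →ₗ[ℝ] ℝ)
    (hΛ : ∀ f, 0 ≤ f → 0 ≤ Λ f) :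
    ∃ μ : Measure X, IsFiniteMeasure μ ∧ ∀ f : C(X, ℝ), ∫ x, f x ∂μ = Λ f := by
  let T : CompactlySupportedContinuousMap X ℝ →ₚ[ℝ] ℝ := PositiveLinearMap.mk₀
    { toFun := fun f => Λ f.toContinuousMap
      map_add' := fun f g => Λ.map_add f.toContinuousMap g.toContinuousMap
      map_smul' := fun a f => Λ.map_smul a f.toContinuousMap } fun f hf => hΛ _ hf
  refine ⟨RealRMK.rieszMeasure T, inferInstance, fun f => ?_⟩
  exact RealRMK.integral_rieszMeasure T ⟨f, .of_compactSpace _⟩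

/-! ### Strong duality -/

namespace Persuasion

section

variable {Ω : Type u} [Fintype Ω] {N : Type w} [Fintype N]

namespace DualFeasible

variable {v v' : Ω → (N → Belief Ω) → ℝ} {V V' : Ω → ℝ} {φ φ' : Ω → N → Belief Ω → ℝ}

theorem smul (h : DualFeasible v V φ) {a : ℝ} (ha : 0 ≤ a) :
    DualFeasible (fun ω x => a * v ω x) (fun ω => a * V ω) fun ω i x => a * φ ω i x where
  continuous ω i := continuous_const.mul (h.continuous ω i)
  le ω x := by
    rw [← Finset.mul_sum, ← mul_add]
    exact mul_le_mul_of_nonneg_left (h.le ω x) ha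
  orthogonal i x := by
    simp_rw [mul_left_comm _ a, ← Finset.mul_sum, h.orthogonal, mul_zero]

theorem add (h : DualFeasible v V φ) (h' : DualFeasible v' V' φ') :
    DualFeasible (fun ω x => v ω x + v' ω x) (fun ω => V ω + V' ω)
      fun ω i x => φ ω i x + φ' ω i x where
  continuous ω i := (h.continuous ω i).add (h'.continuous ω i)
  le ω x := by
    rw [Finset.sum_add_distrib]
    linarith [h.le ω x, h'.le ω x]
  orthogonal i x := by
    simp_rw [mul_add, Finset.sum_add_distrib, h.orthogonal, h'.orthogonal, add_zero]

theorem of_le_const (h : ∀ ω x, v ω x ≤ V ω) : DualFeasible v V fun _ _ _ => 0 where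
  continuous _ _ := continuous_const
  le ω x := by simpa using h ω x
  orthogonal i x := by simp

/-- The payoff without information bounds the dual objective from below. -/
theorem sum_le (h : DualFeasible v V φ) (p : Belief Ω) :
    ∑ ω, p ω * v ω (fun _ => p) ≤ ∑ ω, p ω * V ω := by
  calc ∑ ω, p ω * v ω (fun _ => p) ≤ ∑ ω, p ω * (V ω + ∑ i, φ ω i p) :=
        Finset.sum_le_sum fun ω _ => mul_le_mul_of_nonneg_left (h.le ω _) (stdSimplex.zero_le p ω)
    _ = ∑ ω, p ω * V ω := by
        simp_rw [mul_add, Finset.sum_add_distrib, Finset.mul_sum]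
        rw [Finset.sum_comm (t := Finset.univ (α := N))]
        simp [h.orthogonal]

end DualFeasible

/-- A lower bound of the dual values is a lower bound for the expectations, with respect to a
suitable plan, of all continuous functions above the utility. -/
theorem exists_isPlan (p : Belief Ω) (v : Ω → (N → Belief Ω) → ℝ) (c : ℝ)
    (hc : ∀ V φ, DualFeasible v V φ → c ≤ ∑ ω, p ω * V ω) :
    ∃ μ : Ω → Measure (N → Belief Ω), IsPlan p μ ∧
      ∀ f : Ω → C(N → Belief Ω, ℝ), (∀ ω x, v ω x ≤ f ω x) → c ≤ ∑ ω, ∫ x, f ω x ∂(μ ω) := by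
  classical
  -- Pairs with `a = 0` make `L g` at most the dual values of the utility `g`; pairs with `a > 0`
  -- encode the bound `c` for `v`, which need not be continuous.
  obtain ⟨L, hL⟩ := exists_linearMap_le_of_cone
    (fun (g : Ω → C(N → Belief Ω, ℝ)) r => ∃ a V φ, 0 ≤ a ∧
      DualFeasible (fun ω x => g ω x + a * v ω x) V φ ∧ r = ∑ ω, p ω * V ω - a * c)
    (by
      rintro b hb g r ⟨a, V, φ, ha, h, rfl⟩
      refine ⟨b * a, fun ω => b * V ω, fun ω i x => b * φ ω i x, by positivity, ?_, ?_⟩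
      · convert! h.smul hb.le using 3
        simp; ring
      · simp_rw [mul_left_comm _ b, ← Finset.mul_sum]
        ring)
    (by
      rintro g g' r r' ⟨a, V, φ, ha, h, rfl⟩ ⟨a', V', φ', ha', h', rfl⟩
      refine ⟨a + a', fun ω => V ω + V' ω, fun ω i x => φ ω i x + φ' ω i x, by positivity, ?_, ?_⟩
      · convert! h.add h' using 3
        simp; ring
      · simp_rw [mul_add, Finset.sum_add_distrib]
        ring)
    (fun g => ⟨_, 0, fun ω => ‖g ω‖, _, le_rfl, .of_le_const fun ω x => by
      simpa using (le_abs_self _).trans ((g ω).norm_coe_le_norm x), rfl⟩)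
    (by
      rintro r ⟨a, V, φ, ha, h, rfl⟩
      -- Over the origin, `a = 0` is the dual of the zero utility, whose values are nonnegative by
      -- `sum_le`; `a > 0` rescales to a feasible point for `v`.
      rcases ha.eq_or_lt with rfl | ha
      · have := h.sum_le p
        simpa using this
      · have h1 := h.smul (inv_pos.2 ha).le
        simp only [Pi.zero_apply, ContinuousMap.zero_apply, zero_add,
          inv_mul_cancel_left₀ ha.ne'] at h1
        have h2 := hc _ _ h1
        simp_rw [mul_left_comm _ a⁻¹, ← Finset.mul_sum] at h2
        rw [le_inv_mul_iff₀ ha] at h2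
        linarith)
  have hL0 (g : Ω → C(N → Belief Ω, ℝ)) (V φ) (h : DualFeasible (fun ω x => g ω x) V φ) :
      L g ≤ ∑ ω, p ω * V ω :=
    hL g _ ⟨0, V, φ, le_rfl, by simpa using h, by simp⟩
  have hpos (g : Ω → C(N → Belief Ω, ℝ)) (hg : 0 ≤ g) : 0 ≤ L g := by
    have := hL0 (-g) (fun _ => 0) _ (.of_le_const fun ω x => by simpa using hg ω x)
    simpa using this
  have hΛ (ω : Ω) := ContinuousMap.exists_measure_integral_eq
    (L ∘ₗ LinearMap.single ℝ (fun _ : Ω => C(N → Belief Ω, ℝ)) ω) fun f hf => hpos _ <| by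
      rw [LinearMap.coe_single]
      exact Pi.single_nonneg.2 hf
  choose μ hfin hμ using hΛ
  have hsum (g : Ω → C(N → Belief Ω, ℝ)) : ∑ ω, ∫ x, g ω x ∂(μ ω) = L g := by
    simp_rw [hμ]
    conv_rhs => rw [← Finset.univ_sum_single g, map_sum]
    rfl
  have hV (V : Ω → ℝ) : L (fun ω => .const _ (V ω)) = ∑ ω, p ω * V ω := by
    refine le_antisymm (hL0 _ V _ (.of_le_const fun ω x => le_rfl)) ?_
    have := hL0 (fun ω => .const _ (-V ω)) (fun ω => -V ω) _ (.of_le_const fun ω x => le_rfl)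
    rw [show (fun ω => ContinuousMap.const (N → Belief Ω) (-V ω)) =
      -fun ω => ContinuousMap.const (N → Belief Ω) (V ω) from rfl, map_neg] at this
    simpa using this
  refine ⟨μ, ⟨hfin, fun ω => ?_, fun i φ hφ horth => ?_⟩, fun f hf => ?_⟩
  · have h1 := hsum fun ω' => .const _ (if ω' = ω then 1 else 0)
    rw [hV] at h1
    have h2 : ∑ ω', (if ω' = ω then (μ ω').real Set.univ else 0) = p ω := by
      simpa using h1
    rw [Finset.sum_ite_eq' Finset.univ ω fun ω' => (μ ω').real Set.univ] at h2
    rw [← h2]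
    simp
  · have hcont (ω : Ω) : Continuous fun x : N → Belief Ω => φ ω (x i) :=
      (hφ ω).comp (continuous_apply i)
    -- The utility `ψ ω (x i)` is dominated by itself with `V = 0`. Applied to `φ` and `-φ`, this
    -- gives annihilation.
    have hle (ψ : Ω → Belief Ω → ℝ) (hψ : ∀ ω, Continuous (ψ ω))
        (ho : ∀ x : Belief Ω, ∑ ω, x ω * ψ ω x = 0) :
        L (fun ω => ⟨fun x => ψ ω (x i), (hψ ω).comp (continuous_apply i)⟩) ≤ 0 := by
      refine (hL0 _ (fun _ => 0) (fun ω j => if j = i then ψ ω else 0) ⟨fun ω j => ?_, fun ω x => ?_,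
        fun j x => ?_⟩).trans_eq (by simp)
      · split_ifs
        · exact hψ ω
        · exact continuous_zero
      · simp [ite_apply]
      · split_ifs
        · exact ho x
        · simp
    have h1 := hsum fun ω => ⟨fun x => φ ω (x i), hcont ω⟩
    refine h1.trans (le_antisymm (hle φ hφ horth) ?_)
    have h2 := hle (fun ω x => -φ ω x) (fun ω => (hφ ω).neg) fun x => by simp [horth]
    rw [show (fun ω => (⟨fun x => -φ ω (x i), ((hφ ω).neg).comp (continuous_apply i)⟩ :
        C(N → Belief Ω, ℝ))) = -fun ω => ⟨fun x => φ ω (x i), hcont ω⟩ from rfl, map_neg] at h2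
    simpa using h2
  · rw [hsum]
    -- Here `a = 1`: since `-f + v ≤ 0`, the point `V = 0`, `φ = 0` is feasible, whence `L (-f) ≤
    -- -c`.
    have := hL (-f) _ ⟨1, fun _ => 0, _, zero_le_one, .of_le_const fun ω x => ?_, rfl⟩
    · simpa using this
    · simpa using hf ω x

open Filter Topology in
/-- The expected utility of a plan inherits lower bounds that hold for all continuous functions
above the utility. -/
theorem IsPlan.le_integral_of_forall_continuous {p : Belief Ω} {μ : Ω → Measure (N → Belief Ω)}
    (h : IsPlan p μ) {v : Ω → (N → Belief Ω) → ℝ} (hv : ∀ ω, UpperSemicontinuous (v ω)) {c : ℝ}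
    (hc : ∀ f : Ω → C(N → Belief Ω, ℝ), (∀ ω x, v ω x ≤ f ω x) → c ≤ ∑ ω, ∫ x, f ω x ∂(μ ω)) :
    (∀ ω, Integrable (v ω) (μ ω)) ∧ c ≤ ∑ ω, ∫ x, v ω x ∂(μ ω) := by
  classical
  have := h.isFinite
  have hB (ω : Ω) : ∃ B, ∀ x, v ω x ≤ B := by
    obtain ⟨B, hB⟩ := UpperSemicontinuousOn.bddAbove_of_isCompact isCompact_univ
      ((hv ω).upperSemicontinuousOn Set.univ)
    exact ⟨B, fun x => hB ⟨x, trivial, rfl⟩⟩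
  choose B hB using hB
  choose g hgc hvg hgB hlim using fun ω => (hv ω).exists_continuous_tendsto (hB ω)
  have hgi (ω : Ω) (k : ℕ) : Integrable (g ω k) (μ ω) := by
    obtain ⟨C, hC⟩ := isCompact_univ.exists_bound_of_continuousOn (hgc ω k).continuousOn
    exact .of_bound (hgc ω k).measurable.aestronglyMeasurable C (ae_of_all _ fun x => hC _ trivial)
  have hck (k : ℕ) : c ≤ ∑ ω, ∫ x, g ω k x ∂(μ ω) :=
    hc (fun ω => ⟨g ω k, hgc ω k⟩) fun ω x => hvg ω k x
  have hvi (ω : Ω) : Integrable (v ω) (μ ω) := by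
    have hm : Measurable (v ω) := (hv ω).measurable
    have hgap : Integrable (fun x => B ω - v ω x) (μ ω) := by
      refine ⟨(measurable_const.sub hm).aestronglyMeasurable, ?_⟩
      rw [hasFiniteIntegral_iff_ofReal (ae_of_all _ fun x => sub_nonneg.2 (hB ω x))]
      -- `D` bounds the integral of the nonnegative gap `B ω - g ω k` uniformly in `k`, so Fatou
      -- makes `B ω - v ω` integrable.
      let D : ℝ := ∑ ω', ∫ _, B ω' ∂(μ ω') - c
      have hk (k : ℕ) : ∫⁻ x, ENNReal.ofReal (B ω - g ω k x) ∂(μ ω) ≤ ENNReal.ofReal D := by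
        have hs : Integrable (fun x => B ω - g ω k x) (μ ω) := (integrable_const _).sub (hgi ω k)
        rw [← ofReal_integral_eq_lintegral_ofReal hs (ae_of_all _ fun x => sub_nonneg.2 (hgB ω k x))]
        refine ENNReal.ofReal_le_ofReal ?_
        calc ∫ x, (B ω - g ω k x) ∂(μ ω) ≤ ∑ ω', ∫ x, (B ω' - g ω' k x) ∂(μ ω') :=
              Finset.single_le_sum (f := fun ω' => ∫ x, (B ω' - g ω' k x) ∂(μ ω'))
                (fun ω' _ => integral_nonneg fun x => sub_nonneg.2 (hgB ω' k x))
                (Finset.mem_univ ω)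
          _ = ∑ ω', ∫ _, B ω' ∂(μ ω') - ∑ ω', ∫ x, g ω' k x ∂(μ ω') := by
              rw [← Finset.sum_sub_distrib]
              exact Finset.sum_congr rfl fun ω' _ => integral_sub (integrable_const _) (hgi ω' k)
          _ ≤ D := sub_le_sub_left (hck k) _
      calc ∫⁻ x, ENNReal.ofReal (B ω - v ω x) ∂(μ ω)
          = ∫⁻ x, liminf (fun k => ENNReal.ofReal (B ω - g ω k x)) atTop ∂(μ ω) :=
            lintegral_congr fun x => (ENNReal.tendsto_ofReal
              ((hlim ω x).const_sub (B ω))).liminf_eq.symm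
        _ ≤ liminf (fun k => ∫⁻ x, ENNReal.ofReal (B ω - g ω k x) ∂(μ ω)) atTop :=
            lintegral_liminf_le fun k =>
              (measurable_const.sub (hgc ω k).measurable).ennreal_ofReal
        _ ≤ liminf (fun _ : ℕ => ENNReal.ofReal D) atTop := liminf_le_liminf (.of_forall hk)
        _ < ⊤ := by simp
    exact ((integrable_const (B ω)).sub hgap).congr (ae_of_all _ fun x => sub_sub_cancel _ _)
  refine ⟨hvi, ge_of_tendsto' (x := atTop) (tendsto_finsetSum _ fun ω _ => ?_) hck⟩
  refine tendsto_integral_of_dominated_convergence (fun x => |v ω x| + |B ω|)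
    (fun k => (hgi ω k).aestronglyMeasurable) ((hvi ω).abs.add (integrable_const _))
    (fun k => ae_of_all _ fun x => ?_) (ae_of_all _ fun x => hlim ω x)
  rw [Real.norm_eq_abs, abs_le]
  constructor
  · linarith [neg_abs_le (v ω x), abs_nonneg (B ω), hvg ω k x]
  · linarith [le_abs_self (B ω), abs_nonneg (v ω x), hgB ω k x]

variable [MeasurableSpace Ω] [DiscreteMeasurableSpace Ω] [Nonempty Ω]

/-- Strong duality: a lower bound of the dual values is reached by an information structure. -/
theorem exists_payoff_ge (p : Belief Ω) (hp : ∀ ω, 0 < p ω) {v : Ω → (N → Belief Ω) → ℝ}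
    (hv : ∀ ω, UpperSemicontinuous (v ω)) {c : ℝ}
    (hc : ∀ V φ, DualFeasible v V φ → c ≤ ∑ ω, p ω * V ω) :
    ∃ r ∈ payoffs.{u, w, t} p v, c ≤ r := by
  obtain ⟨μ, hμ, hf⟩ := exists_isPlan p v c hc
  obtain ⟨hi, hle⟩ := hμ.le_integral_of_forall_continuous hv hf
  exact ⟨_, hμ.mem_payoffs hp (fun ω => (hv ω).measurable) hi, hle⟩

/-- Strong duality at `c = sInf (dualValues p v)` yields a payoff at least `c`; weak duality makes
it equal to `c` and maximal. -/
theorem value_isGreatest_and_isGLB (p : Belief Ω) (hp : ∀ ω, 0 < p ω)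
    {v : Ω → (N → Belief Ω) → ℝ} (hv : ∀ ω, UpperSemicontinuous (v ω)) :
    IsGreatest (payoffs.{u, w, t} p v) (value.{u, w, t} p v) ∧
      IsGLB (dualValues p v) (value.{u, w, t} p v) := by
  have hne : (dualValues p v).Nonempty := by
    have hB (ω : Ω) : ∃ B, ∀ x, v ω x ≤ B := by
      obtain ⟨B, hB⟩ := UpperSemicontinuousOn.bddAbove_of_isCompact isCompact_univ
        ((hv ω).upperSemicontinuousOn Set.univ)
      exact ⟨B, fun x => hB ⟨x, trivial, rfl⟩⟩
    choose B hB using hB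
    exact ⟨_, B, _, .of_le_const hB, rfl⟩
  have hbdd : BddBelow (dualValues p v) :=
    ⟨∑ ω, p ω * v ω (fun _ => p), by rintro _ ⟨V, φ, h, rfl⟩; exact h.sum_le p⟩
  have hglb := isGLB_csInf hne hbdd
  obtain ⟨r, hr, hcr⟩ := exists_payoff_ge.{u, w, t} p hp hv
    fun V φ h => hglb.1 ⟨V, φ, h, rfl⟩
  have hup : ∀ r' ∈ payoffs.{u, w, t} p v, r' ≤ sInf (dualValues p v) := fun r' hr' =>
    le_csInf hne (by rintro _ ⟨V, φ, h, rfl⟩; exact h.payoff_le p hr')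
  have hg : IsGreatest (payoffs.{u, w, t} p v) r := ⟨hr, fun r' hr' => (hup r' hr').trans hcr⟩
  have hval : value.{u, w, t} p v = r := hg.csSup_eq
  rw [hval]
  exact ⟨hg, by rwa [le_antisymm hcr (hup r hr)] at hglb⟩

end

end Persuasion

/-! ### The modulus of continuity of the utility -/

namespace Persuasion

section

variable {Ω : Type u} [Fintype Ω] {N : Type w} [Fintype N]

theorem tvDist_nonneg (x x' : Belief Ω) : 0 ≤ tvDist x x' :=
  Finset.sum_nonneg fun _ _ => abs_nonneg _

theorem dist_le_tvDist (x x' : Belief Ω) : dist x x' ≤ tvDist x x' := by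
  rw [Subtype.dist_eq, dist_pi_le_iff (tvDist_nonneg x x')]
  exact fun ω => Finset.single_le_sum (f := fun ω => |x ω - x' ω|) (fun _ _ => abs_nonneg _)
    (Finset.mem_univ ω)

section

variable {v : Ω → (N → Belief Ω) → ℝ}

omit [Fintype N] in
theorem supNorm_nonneg : 0 ≤ supNorm v :=
  Real.iSup_nonneg fun _ => abs_nonneg _

omit [Fintype N] in
theorem abs_le_supNorm (hv : ∀ ω, Continuous (v ω)) (ω : Ω) (x : N → Belief Ω) :
    |v ω x| ≤ supNorm v := by
  have h (ω : Ω) : ∃ C, ∀ x, |v ω x| ≤ C := by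
    obtain ⟨C, hC⟩ := isCompact_univ.exists_bound_of_continuousOn (hv ω).continuousOn
    exact ⟨C, fun x => hC x trivial⟩
  choose C hC using h
  refine le_ciSup (f := fun z : Ω × (N → Belief Ω) => |v z.1 z.2|) ⟨∑ ω, |C ω|, ?_⟩ (ω, x)
  rintro _ ⟨z, rfl⟩
  exact ((hC z.1 z.2).trans (le_abs_self _)).trans
    (Finset.single_le_sum (f := fun ω => |C ω|) (fun _ _ => abs_nonneg _) (Finset.mem_univ z.1))

omit [Fintype N] in
theorem modulus_nonneg (ε : ℝ) : 0 ≤ modulus v ε :=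
  Real.sSup_nonneg (by rintro _ ⟨_, _, _, _, _, _, rfl⟩; exact abs_nonneg _)

omit [Fintype N] in
open Classical in
theorem abs_sub_le_modulus (hv : ∀ ω, Continuous (v ω)) (ω : Ω) (i : N) (y : N → Belief Ω)
    (x x' : Belief Ω) :
    |v ω (Function.update y i x) - v ω (Function.update y i x')| ≤ modulus v (tvDist x x') := by
  refine le_csSup ⟨supNorm v + supNorm v, ?_⟩ ⟨ω, i, y, x, x', le_rfl, rfl⟩
  rintro _ ⟨ω, i, y, x, x', -, rfl⟩
  exact (abs_sub _ _).trans (add_le_add (abs_le_supNorm hv _ _) (abs_le_supNorm hv _ _))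

open Filter Topology in
theorem tendsto_modulus (hv : ∀ ω, Continuous (v ω)) : Tendsto (modulus v) (𝓝 0) (𝓝 0) := by
  classical
  refine Metric.tendsto_nhds.2 fun ε hε => ?_
  have h (ω : Ω) : ∃ δ > 0, ∀ y y', dist y y' < δ → dist (v ω y) (v ω y') < ε / 2 :=
    Metric.uniformContinuous_iff.1 (CompactSpace.uniformContinuous_of_continuous (hv ω)) _
      (half_pos hε)
  choose δ hδ hd using h
  have hev : ∀ᶠ η in 𝓝 (0 : ℝ), ∀ ω, η < δ ω :=
    eventually_all.2 fun ω => eventually_lt_nhds (hδ ω)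
  filter_upwards [hev] with η hη
  rw [Real.dist_0_eq_abs, abs_of_nonneg (modulus_nonneg η)]
  -- For `η < 0` the set is empty and its `sSup` is `0`; nonnegativity of `ε / 2` covers this case.
  refine (Real.sSup_le ?_ (half_pos hε).le).trans_lt (half_lt_self hε)
  rintro _ ⟨ω, i, y, x, x', hx, rfl⟩
  refine (hd ω _ _ (((dist_pi_le_iff dist_nonneg).2 fun j => ?_ :
    dist _ _ ≤ dist x x').trans_lt ((dist_le_tvDist x x').trans_lt (hx.trans_lt (hη ω))))).le
  by_cases hj : j = i
  · subst hj; simp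
  · simp [Function.update_of_ne hj]

-- Continuity alone is lost in pointwise limits; this estimate survives them and restores it.
open Filter Topology in
theorem continuous_of_abs_sub_le_modulus (hv : ∀ ω, Continuous (v ω)) {f : Belief Ω → ℝ} {C : ℝ}
    (hf : ∀ x x', |f x - f x'| ≤ 2 * modulus v (tvDist x x') + C * tvDist x x') :
    Continuous f := by
  refine continuous_iff_continuousAt.2 fun x' => ?_
  have htv : Tendsto (fun x => tvDist x x') (𝓝 x') (𝓝 0) := by
    have hc : Continuous fun x : Belief Ω => tvDist x x' :=
      continuous_finsetSum _ fun ω _ => ((continuous_belief_apply ω).sub continuous_const).abs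
    simpa [tvDist] using hc.tendsto x'
  have h := (((tendsto_modulus hv).comp htv).const_mul 2).add (htv.const_mul C)
  rw [mul_zero, mul_zero, add_zero] at h
  exact tendsto_iff_dist_tendsto_zero.2
    (squeeze_zero (fun _ => dist_nonneg) (fun x => hf x x') h)

end

/-! ### Tightening, a priori bounds and dual attainment -/

open Classical in
/-- The smallest function that can replace `φ ω i` without violating the inequality constraints
of the dual problem. -/
noncomputable def tightening (v : Ω → (N → Belief Ω) → ℝ) (V : Ω → ℝ) (φ : Ω → N → Belief Ω → ℝ)
    (i : N) (ω : Ω) (x : Belief Ω) : ℝ :=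
  ⨆ y : N → Belief Ω,
    (v ω (Function.update y i x) - V ω - ∑ j ∈ Finset.univ.erase i, φ ω j (y j))

open Classical in
/-- The dual variables after the functions of receiver `i` are replaced by their tightening,
corrected so as to restore the equality constraint. -/
noncomputable def tighten (v : Ω → (N → Belief Ω) → ℝ) (V : Ω → ℝ) (φ : Ω → N → Belief Ω → ℝ)
    (i : N) (ω : Ω) (j : N) (x : Belief Ω) : ℝ :=
  if j = i then tightening v V φ i ω x - ∑ ω', x ω' * tightening v V φ i ω' x else φ ω j x

namespace DualFeasible

variable {v : Ω → (N → Belief Ω) → ℝ} {V : Ω → ℝ} {φ : Ω → N → Belief Ω → ℝ}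
  (h : DualFeasible v V φ)

include h

/-- At the point mass on `ω` orthogonality has a single term. All bounds below start from this
normalization. -/
theorem apply_vertex [DecidableEq Ω] (ω : Ω) (i : N) :
    φ ω i (stdSimplex.vertex (S := ℝ) ω) = 0 := by
  have := h.orthogonal i (stdSimplex.vertex (S := ℝ) ω)
  simpa [Pi.single_apply] using this

theorem le_update [DecidableEq N] (ω : Ω) (i : N) (y : N → Belief Ω) (x : Belief Ω) :
    v ω (Function.update y i x) ≤
      V ω + (φ ω i x + ∑ j ∈ Finset.univ.erase i, φ ω j (y j)) := by
  refine (h.le ω _).trans_eq ?_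
  rw [← Finset.add_sum_erase _ _ (Finset.mem_univ i), Function.update_self]
  congr 2
  exact Finset.sum_congr rfl fun j hj => by rw [Function.update_of_ne (Finset.ne_of_mem_erase hj)]

theorem bddAbove_tightening [DecidableEq N] (i : N) (ω : Ω) (x : Belief Ω) :
    BddAbove (Set.range fun y : N → Belief Ω =>
      v ω (Function.update y i x) - V ω - ∑ j ∈ Finset.univ.erase i, φ ω j (y j)) :=
  ⟨φ ω i x, Set.forall_mem_range.2 fun y => by linarith [h.le_update ω i y x]⟩

open Classical in
theorem le_tightening (i : N) (ω : Ω) (x : Belief Ω) (y : N → Belief Ω) :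
    v ω (Function.update y i x) - V ω - ∑ j ∈ Finset.univ.erase i, φ ω j (y j) ≤
      tightening v V φ i ω x :=
  le_ciSup (h.bddAbove_tightening i ω x) y

theorem tightening_le (i : N) (ω : Ω) (x : Belief Ω) : tightening v V φ i ω x ≤ φ ω i x := by
  classical
  have : Nonempty (Belief Ω) := ⟨x⟩
  exact ciSup_le fun y => by linarith [h.le_update ω i y x]

theorem neg_supNorm_le (hv : ∀ ω, Continuous (v ω)) (ω : Ω) : -supNorm v ≤ V ω := by
  classical
  have h1 := h.le ω fun _ => stdSimplex.vertex (S := ℝ) ω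
  simp only [h.apply_vertex, Finset.sum_const_zero, add_zero] at h1
  exact (neg_le_of_abs_le (abs_le_supNorm hv ω _)).trans h1

/-- Every `V ω + supNorm v` is nonnegative, so one weighted term is at most the whole sum. -/
theorem mul_add_supNorm_le (hv : ∀ ω, Continuous (v ω)) {p : Belief Ω}
    (hV : ∑ ω, p ω * V ω ≤ supNorm v) (ω : Ω) : p ω * (V ω + supNorm v) ≤ 2 * supNorm v := by
  calc p ω * (V ω + supNorm v) ≤ ∑ ω, p ω * (V ω + supNorm v) :=
        Finset.single_le_sum (f := fun ω => p ω * (V ω + supNorm v)) (fun ω' _ =>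
          mul_nonneg (stdSimplex.zero_le p ω') (by linarith [h.neg_supNorm_le hv ω']))
          (Finset.mem_univ ω)
    _ = ∑ ω, p ω * V ω + supNorm v := by
        simp_rw [mul_add, Finset.sum_add_distrib, ← Finset.sum_mul]
        rw [stdSimplex.sum_eq_one, one_mul]
    _ ≤ 2 * supNorm v := by linarith

theorem neg_le_tightening (hv : ∀ ω, Continuous (v ω)) (i : N) (ω : Ω) (x : Belief Ω) :
    -(V ω + supNorm v) ≤ tightening v V φ i ω x := by
  classical
  have h1 := h.le_tightening i ω x fun _ => stdSimplex.vertex (S := ℝ) ω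
  simp only [h.apply_vertex, Finset.sum_const_zero, sub_zero] at h1
  linarith [neg_le_of_abs_le (abs_le_supNorm hv ω
    (Function.update (fun _ => stdSimplex.vertex (S := ℝ) ω) i x))]

/-- For each `y`, the constraint with receiver `i` moved to the vertex `ω` bounds `-V ω - ∑ j ≠ i, φ
ω j (y j)` by `supNorm v`. -/
theorem tightening_le_supNorm (hv : ∀ ω, Continuous (v ω)) (i : N) (ω : Ω) (x : Belief Ω) :
    tightening v V φ i ω x ≤ 2 * supNorm v := by
  classical
  have : Nonempty (Belief Ω) := ⟨x⟩
  refine ciSup_le fun y => ?_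
  have h1 := h.le_update ω i y (stdSimplex.vertex (S := ℝ) ω)
  rw [h.apply_vertex] at h1
  linarith [neg_le_of_abs_le (abs_le_supNorm hv ω
    (Function.update y i (stdSimplex.vertex (S := ℝ) ω))),
    le_of_abs_le (abs_le_supNorm hv ω (Function.update y i x))]

theorem abs_tightening_sub_le (hv : ∀ ω, Continuous (v ω)) (i : N) (ω : Ω) (x x' : Belief Ω) :
    |tightening v V φ i ω x - tightening v V φ i ω x'| ≤ modulus v (tvDist x x') := by
  classical
  have key (x x' : Belief Ω) :
      tightening v V φ i ω x ≤ tightening v V φ i ω x' + modulus v (tvDist x x') := by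
    have : Nonempty (Belief Ω) := ⟨x⟩
    refine ciSup_le fun y => ?_
    linarith [h.le_tightening i ω x' y, le_of_abs_le (abs_sub_le_modulus hv ω i y x x')]
  have hsymm : tvDist x' x = tvDist x x' := by simp [tvDist, abs_sub_comm]
  refine abs_sub_le_iff.2 ⟨by linarith [key x x'], ?_⟩
  have := key x' x
  rw [hsymm] at this
  linarith

end DualFeasible

variable [Nonempty Ω] {p : Belief Ω} (hp : ∀ ω, 0 < p ω)

omit [Nonempty Ω] in
theorem iInf_belief_le (ω : Ω) : ⨅ ω', p ω' ≤ p ω :=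
  ciInf_le (Set.finite_range _).bddBelow ω

include hp in
theorem iInf_belief_pos : 0 < ⨅ ω', p ω' := by
  obtain ⟨ω, hω⟩ := exists_eq_ciInf_of_finite (f := fun ω => p ω)
  rw [← hω]
  exact hp ω

theorem iInf_belief_le_one : ⨅ ω', p ω' ≤ 1 :=
  (iInf_belief_le (Classical.arbitrary Ω)).trans (stdSimplex.le_one p _)

/-- The bounds and the modulus of continuity of dual variables of receiver `i`. -/
structure IsRegular (p : Belief Ω) (v : Ω → (N → Belief Ω) → ℝ) (φ : Ω → N → Belief Ω → ℝ)
    (i : N) : Prop where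
  bounds : ∀ ω x, -(2 / p ω * supNorm v) ≤ φ ω i x ∧
    φ ω i x ≤ (2 + 2 / ⨅ ω', p ω') * supNorm v
  modulus : ∀ ω x x', |φ ω i x - φ ω i x'| ≤ 2 * modulus v (tvDist x x') +
    2 * Fintype.card N / (⨅ ω', p ω') * supNorm v * tvDist x x'

variable {v : Ω → (N → Belief Ω) → ℝ} {V : Ω → ℝ} {φ : Ω → N → Belief Ω → ℝ}

include hp

omit [Nonempty Ω] in
theorem DualFeasible.add_supNorm_le (h : DualFeasible v V φ) (hv : ∀ ω, Continuous (v ω))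
    (hV : ∑ ω, p ω * V ω ≤ supNorm v) (ω : Ω) : V ω + supNorm v ≤ 2 / p ω * supNorm v := by
  rw [div_mul_eq_mul_div, le_div_iff₀ (hp ω), mul_comm]
  exact h.mul_add_supNorm_le hv hV ω

omit [Fintype N] in
theorem two_div_mul_supNorm_le (ω : Ω) :
    2 / p ω * supNorm v ≤ 2 / (⨅ ω', p ω') * supNorm v := by
  have := iInf_belief_pos hp
  have := supNorm_nonneg (v := v)
  gcongr
  exact iInf_belief_le ω

theorem DualFeasible.abs_tightening_le (h : DualFeasible v V φ) (hv : ∀ ω, Continuous (v ω))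
    (hV : ∑ ω, p ω * V ω ≤ supNorm v) (i : N) (ω : Ω) (x : Belief Ω) :
    |tightening v V φ i ω x| ≤ 2 / (⨅ ω', p ω') * supNorm v := by
  refine abs_le.2 ⟨?_, (h.tightening_le_supNorm hv i ω x).trans ?_⟩
  · linarith [h.neg_le_tightening hv i ω x, h.add_supNorm_le hp hv hV ω,
      two_div_mul_supNorm_le hp (v := v) ω]
  · refine mul_le_mul_of_nonneg_right ?_ supNorm_nonneg
    rw [le_div_iff₀ (iInf_belief_pos hp)]
    linarith [iInf_belief_le_one (p := p)]

/-- One modulus comes from the tightening, the other from its `x`-average. The change of the weights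
costs the sup bound of the tightening times `tvDist x x'`. -/
theorem DualFeasible.abs_tighten_sub_le (h : DualFeasible v V φ) (hv : ∀ ω, Continuous (v ω))
    (hV : ∑ ω, p ω * V ω ≤ supNorm v) (i : N) (ω : Ω) (x x' : Belief Ω) :
    |tighten v V φ i ω i x - tighten v V φ i ω i x'| ≤ 2 * Persuasion.modulus v (tvDist x x') +
      2 * Fintype.card N / (⨅ ω', p ω') * supNorm v * tvDist x x' := by
  have h1 := h.abs_tightening_sub_le hv i ω x x'
  have h2 : |∑ ω', (x ω' * tightening v V φ i ω' x - x' ω' * tightening v V φ i ω' x')| ≤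
      Persuasion.modulus v (tvDist x x') + 2 / (⨅ ω', p ω') * supNorm v * tvDist x x' := by
    have hsum : Persuasion.modulus v (tvDist x x') + 2 / (⨅ ω', p ω') * supNorm v * tvDist x x' =
        ∑ ω', (x ω' * Persuasion.modulus v (tvDist x x') +
          2 / (⨅ ω', p ω') * supNorm v * |x ω' - x' ω'|) := by
      rw [Finset.sum_add_distrib, ← Finset.sum_mul, ← Finset.mul_sum, stdSimplex.sum_eq_one,
        one_mul]
      rfl
    rw [hsum]
    refine (Finset.abs_sum_le_sum_abs _ _).trans (Finset.sum_le_sum fun ω' _ => ?_)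
    calc |x ω' * tightening v V φ i ω' x - x' ω' * tightening v V φ i ω' x'|
        = |x ω' * (tightening v V φ i ω' x - tightening v V φ i ω' x') +
            tightening v V φ i ω' x' * (x ω' - x' ω')| := by congr 1; ring
      _ ≤ x ω' * |tightening v V φ i ω' x - tightening v V φ i ω' x'| +
            |tightening v V φ i ω' x'| * |x ω' - x' ω'| := by
          refine (abs_add_le _ _).trans_eq ?_
          rw [abs_mul, abs_mul, abs_of_nonneg (stdSimplex.zero_le x ω')]
      _ ≤ _ := by
          gcongr
          · exact stdSimplex.zero_le x ω'
          · exact h.abs_tightening_sub_le hv i ω' x x'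
          · exact h.abs_tightening_le hp hv hV i ω' x'
  have h3 : 2 / (⨅ ω', p ω') * supNorm v * tvDist x x' ≤
      2 * Fintype.card N / (⨅ ω', p ω') * supNorm v * tvDist x x' := by
    have := iInf_belief_pos hp
    have := supNorm_nonneg (v := v)
    have := tvDist_nonneg x x'
    have : (1 : ℝ) ≤ Fintype.card N := by exact_mod_cast Fintype.card_pos_iff.2 ⟨i⟩
    gcongr
    linarith
  simp only [tighten, if_true]
  rw [sub_sub_sub_comm, ← Finset.sum_sub_distrib]
  linarith [abs_sub (tightening v V φ i ω x - tightening v V φ i ω x')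
    (∑ ω', (x ω' * tightening v V φ i ω' x - x' ω' * tightening v V φ i ω' x'))]

/-- The tightening lies below `φ`, so its `x`-average is at most `0`. Subtracting the average only
raises the function, and the inequality survives. -/
theorem DualFeasible.tighten (h : DualFeasible v V φ) (hv : ∀ ω, Continuous (v ω))
    (hV : ∑ ω, p ω * V ω ≤ supNorm v) (i : N) :
    DualFeasible v V (tighten v V φ i) where
  continuous ω j := by
    by_cases hj : j = i
    · subst hj
      exact continuous_of_abs_sub_le_modulus hv (h.abs_tighten_sub_le hp hv hV j ω)
    · rw [show Persuasion.tighten v V φ i ω j = φ ω j from funext fun x => if_neg hj]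
      exact h.continuous ω j
  orthogonal j x := by
    by_cases hj : j = i
    · subst hj
      simp only [Persuasion.tighten, if_true, mul_sub, Finset.sum_sub_distrib, ← Finset.sum_mul]
      rw [stdSimplex.sum_eq_one, one_mul, sub_self]
    · simp only [Persuasion.tighten, if_neg hj]
      exact h.orthogonal j x
  le ω x := by
    classical
    have h1 := h.le_tightening i ω (x i) x
    rw [Function.update_eq_self] at h1
    have h2 : ∑ ω', x i ω' * tightening v V φ i ω' (x i) ≤ 0 := by
      rw [← h.orthogonal i (x i)]
      exact Finset.sum_le_sum fun ω' _ =>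
        mul_le_mul_of_nonneg_left (h.tightening_le i ω' (x i)) (stdSimplex.zero_le _ ω')
    have h3 : ∑ j ∈ Finset.univ.erase i, Persuasion.tighten v V φ i ω j (x j) =
        ∑ j ∈ Finset.univ.erase i, φ ω j (x j) :=
      Finset.sum_congr rfl fun j hj => if_neg (Finset.ne_of_mem_erase hj)
    rw [← Finset.add_sum_erase _ _ (Finset.mem_univ i), h3]
    simp only [Persuasion.tighten, if_true]
    linarith

theorem DualFeasible.isRegular_tighten (h : DualFeasible v V φ) (hv : ∀ ω, Continuous (v ω))
    (hV : ∑ ω, p ω * V ω ≤ supNorm v) (i : N) : IsRegular p v (Persuasion.tighten v V φ i) i where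
  modulus := h.abs_tighten_sub_le hp hv hV i
  bounds ω x := by
    have h' := h.tighten hp hv hV i
    constructor
    -- The new point is feasible, so it lies above its own tightening, which is at least `-(V ω +
    -- supNorm v)`.
    · linarith [h'.neg_le_tightening hv i ω x, h'.tightening_le i ω x,
        h'.add_supNorm_le hp hv hV ω]
    · have h1 : -(2 / (⨅ ω', p ω') * supNorm v) ≤
          ∑ ω', x ω' * tightening v V φ i ω' x := by
        calc -(2 / (⨅ ω', p ω') * supNorm v) =
              ∑ ω', x ω' * -(2 / (⨅ ω', p ω') * supNorm v) := by
              rw [← Finset.sum_mul, stdSimplex.sum_eq_one, one_mul]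
          _ ≤ _ := Finset.sum_le_sum fun ω' _ => mul_le_mul_of_nonneg_left
              (neg_le_of_abs_le (h.abs_tightening_le hp hv hV i ω' x)) (stdSimplex.zero_le x ω')
      simp only [Persuasion.tighten, if_true]
      rw [add_mul]
      linarith [h.tightening_le_supNorm hv i ω x]

/-- Receivers are treated one at a time: tightening one leaves `V` and the functions of the others
intact. -/
theorem DualFeasible.exists_isRegular (h : DualFeasible v V φ) (hv : ∀ ω, Continuous (v ω))
    (hV : ∑ ω, p ω * V ω ≤ supNorm v) :
    ∃ φ', DualFeasible v V φ' ∧ ∀ i, IsRegular p v φ' i := by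
  classical
  suffices H : ∀ s : Finset N, ∃ φ', DualFeasible v V φ' ∧ ∀ i ∈ s, IsRegular p v φ' i by
    simpa using H Finset.univ
  intro s
  induction s using Finset.induction_on with
  | empty => exact ⟨φ, h, by simp⟩
  | insert i s hi ih =>
    obtain ⟨φ', h', hs⟩ := ih
    refine ⟨_, h'.tighten hp hv hV i, fun j hj => ?_⟩
    rcases Finset.mem_insert.1 hj with rfl | hj
    · exact h'.isRegular_tighten hp hv hV j
    · have hne : j ≠ i := fun e => hi (e ▸ hj)
      have he (ω : Ω) (x : Belief Ω) : Persuasion.tighten v V φ' i ω j x = φ' ω j x := if_neg hne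
      exact ⟨fun ω x => by rw [he]; exact (hs j hj).bounds ω x,
        fun ω x x' => by rw [he, he]; exact (hs j hj).modulus ω x x'⟩

omit [Nonempty Ω] in
theorem DualFeasible.mem_Icc (h : DualFeasible v V φ) (hv : ∀ ω, Continuous (v ω))
    (hV : ∑ ω, p ω * V ω ≤ supNorm v) (ω : Ω) :
    V ω ∈ Set.Icc (-supNorm v) ((2 - p ω) / p ω * supNorm v) := by
  refine ⟨h.neg_supNorm_le hv ω, ?_⟩
  rw [div_mul_eq_mul_div, le_div_iff₀ (hp ω)]
  linarith [h.mul_add_supNorm_le hv hV ω]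

/-- For continuous utilities, the dual problem has a regular solution. -/
theorem exists_isRegular_isLeast (hv : ∀ ω, Continuous (v ω)) :
    ∃ V φ, DualFeasible v V φ ∧ (∀ i, IsRegular p v φ i) ∧ (∑ ω, p ω * V ω ≤ supNorm v) ∧
      IsLeast (dualValues p v) (∑ ω, p ω * V ω) := by
  -- `K` is compact in the product topology by Tychonoff. It is closed because the common modulus
  -- makes the continuity clause automatic.
  let K : Set ((Ω → ℝ) × (Ω → N → Belief Ω → ℝ)) :=
    {z | DualFeasible v z.1 z.2 ∧ ∀ i, IsRegular p v z.2 i} ∩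
      {z | ∑ ω, p ω * z.1 ω ≤ supNorm v}
  have hobj : Continuous fun z : (Ω → ℝ) × (Ω → N → Belief Ω → ℝ) => ∑ ω, p ω * z.1 ω := by
    fun_prop
  have hφ (ω : Ω) (i : N) (x : Belief Ω) :
      Continuous fun z : (Ω → ℝ) × (Ω → N → Belief Ω → ℝ) => z.2 ω i x := by fun_prop
  have hVc (ω : Ω) : Continuous fun z : (Ω → ℝ) × (Ω → N → Belief Ω → ℝ) => z.1 ω := by fun_prop
  have hclosed : IsClosed K := by
    have hK : K = {z | ∀ ω x, v ω x ≤ z.1 ω + ∑ i, z.2 ω i (x i)} ∩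
        {z | ∀ i (x : Belief Ω), ∑ ω, x ω * z.2 ω i x = 0} ∩
        {z | ∀ i ω x, -(2 / p ω * supNorm v) ≤ z.2 ω i x} ∩
        {z | ∀ i ω x, z.2 ω i x ≤ (2 + 2 / ⨅ ω', p ω') * supNorm v} ∩
        {z | ∀ i ω x x', |z.2 ω i x - z.2 ω i x'| ≤ 2 * modulus v (tvDist x x') +
          2 * Fintype.card N / (⨅ ω', p ω') * supNorm v * tvDist x x'} ∩
        {z | ∑ ω, p ω * z.1 ω ≤ supNorm v} := by
      ext z
      constructor
      · rintro ⟨⟨h, hr⟩, hV⟩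
        exact ⟨⟨⟨⟨⟨h.le, h.orthogonal⟩, fun i ω x => ((hr i).bounds ω x).1⟩,
          fun i ω x => ((hr i).bounds ω x).2⟩, fun i => (hr i).modulus⟩, hV⟩
      · rintro ⟨⟨⟨⟨⟨h1, h2⟩, h3⟩, h4⟩, h5⟩, h6⟩
        exact ⟨⟨⟨fun ω i => continuous_of_abs_sub_le_modulus hv (h5 i ω), h1, h2⟩,
          fun i => ⟨fun ω x => ⟨h3 i ω x, h4 i ω x⟩, h5 i⟩⟩, h6⟩
    rw [hK]
    simp only [Set.ofPred_forall]
    refine IsClosed.inter (.inter (.inter (.inter (.inter ?_ ?_) ?_) ?_) ?_)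
      (isClosed_le hobj continuous_const)
    · exact isClosed_iInter fun ω => isClosed_iInter fun x => isClosed_le continuous_const
        ((hVc ω).add (continuous_finsetSum _ fun i _ => hφ ω i (x i)))
    · exact isClosed_iInter fun i => isClosed_iInter fun x => isClosed_eq
        (continuous_finsetSum _ fun ω _ => continuous_const.mul (hφ ω i x)) continuous_const
    · exact isClosed_iInter fun i => isClosed_iInter fun ω => isClosed_iInter fun x =>
        isClosed_le continuous_const (hφ ω i x)
    · exact isClosed_iInter fun i => isClosed_iInter fun ω => isClosed_iInter fun x =>
        isClosed_le (hφ ω i x) continuous_const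
    · exact isClosed_iInter fun i => isClosed_iInter fun ω => isClosed_iInter fun x =>
        isClosed_iInter fun x' => isClosed_le ((hφ ω i x).sub (hφ ω i x')).abs continuous_const
  have hcompact : IsCompact K := by
    refine ((isCompact_univ_pi fun ω => isCompact_Icc
      (a := -supNorm v) (b := (2 - p ω) / p ω * supNorm v)).prod
      (isCompact_univ_pi fun ω => isCompact_univ_pi fun _ : N => isCompact_univ_pi
        fun _ : Belief Ω => isCompact_Icc (a := -(2 / p ω * supNorm v))
          (b := (2 + 2 / ⨅ ω', p ω') * supNorm v))).of_isClosed_subset hclosed ?_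
    rintro z ⟨⟨h, hr⟩, hV⟩
    exact ⟨fun ω _ => h.mem_Icc hp hv hV ω, fun ω _ i _ x _ => (hr i).bounds ω x⟩
  have hconst : ∑ ω, p ω * supNorm v = supNorm v := by
    rw [← Finset.sum_mul, stdSimplex.sum_eq_one, one_mul]
  have hsup : DualFeasible v (fun _ => supNorm v) fun _ _ _ => 0 :=
    .of_le_const fun ω x => le_of_abs_le (abs_le_supNorm hv ω x)
  obtain ⟨φ₀, h₀, hr₀⟩ := hsup.exists_isRegular hp hv hconst.le
  obtain ⟨⟨V, φ⟩, ⟨⟨h, hr⟩, hV⟩, hmin⟩ := hcompact.exists_isMinOn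
    ⟨(_, φ₀), ⟨h₀, hr₀⟩, hconst.le⟩ hobj.continuousOn
  refine ⟨V, φ, h, hr, hV, ⟨V, φ, h, rfl⟩, ?_⟩
  rintro _ ⟨V', φ', h', rfl⟩
  -- A competitor with objective at most `supNorm v` is regularized into `K` with the same `V`; any
  -- other is no better than the minimizer.
  rcases le_total (∑ ω, p ω * V' ω) (supNorm v) with hle | hle
  · obtain ⟨φ'', h'', hr''⟩ := h'.exists_isRegular hp hv hle
    exact hmin (show (V', φ'') ∈ K from ⟨⟨h'', hr''⟩, hle⟩)
  · exact hV.trans hle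

end

end Persuasion

theorem mainTheorem2
    {Ω : Type u} [Fintype Ω] [Nonempty Ω] [MeasurableSpace Ω] [DiscreteMeasurableSpace Ω]
    {N : Type w} [Fintype N]
    (p : Persuasion.Belief Ω) (hp : ∀ ω, 0 < p ω)
    (v : Ω → (N → Persuasion.Belief Ω) → ℝ) (hv : ∀ ω, UpperSemicontinuous (v ω)) :
    -- the value is a genuine maximum over information structures
    IsGreatest (Persuasion.payoffs.{u, w, t} p v) (Persuasion.value.{u, w, t} p v) ∧
    -- it equals the infimum of the dual problem
    IsGLB (Persuasion.dualValues p v) (Persuasion.value.{u, w, t} p v) ∧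
    -- for continuous utilities there is a dual optimum with the stated regularity
    ((∀ ω, Continuous (v ω)) →
      ∃ (V : Ω → ℝ) (φ : Ω → N → Persuasion.Belief Ω → ℝ),
        Persuasion.DualFeasible v V φ ∧
        ∑ ω, p ω * V ω = Persuasion.value.{u, w, t} p v ∧
        (∀ ω, -Persuasion.supNorm v ≤ V ω ∧
          V ω ≤ (2 - p ω) / p ω * Persuasion.supNorm v) ∧
        (∀ ω i x, -(2 / p ω * Persuasion.supNorm v) ≤ φ ω i x ∧
          φ ω i x ≤ (2 + 2 / ⨅ ω', p ω') * Persuasion.supNorm v) ∧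
        (∀ ω i x x', |φ ω i x - φ ω i x'| ≤
          2 * Persuasion.modulus v (Persuasion.tvDist x x') +
            2 * Fintype.card N / (⨅ ω', p ω') * Persuasion.supNorm v *
              Persuasion.tvDist x x')) := by
  obtain ⟨hg, hglb⟩ := Persuasion.value_isGreatest_and_isGLB.{u, w, t} p hp hv
  refine ⟨hg, hglb, fun hc => ?_⟩
  obtain ⟨V, φ, h, hr, hV, hleast⟩ := Persuasion.exists_isRegular_isLeast hp hc
  exact ⟨V, φ, h, hleast.isGLB.unique hglb, h.mem_Icc hp hc hV,
    fun ω i => (hr i).bounds ω, fun ω i => (hr i).modulus ω⟩
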